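/- **Setting.** Let $K\ge 1$ and let $\mathcal D_1,\dots,\mathcal D_K$ be probability distributions supported on $[0,1]$, with means $\theta_1,\dots,\theta_K$. Let $\theta\in(0,1)$ be a threshold and put $\Delta_i=|\theta_i-\theta|$. Pulling arm $i$ for the $s$-th time yields the reward $X_{i,s}\sim\mathcal D_i$, where all $X_{i,s}$ ($1\le i\le K$, $s\ge1$) are independent. Let $T_i(t)$ be the number of pulls of arm $i$ in the first $t$ rounds, $\hat\theta_i(t)=\frac1{T_i(t)}\sum_{s=1}^{T_i(t)}X_{i,s}$, and $\hat\Delta_i(t)=|\hat\theta_i(t)-\theta|$. For $\alpha>0$, the algorithm LSA pulls each arm once in the first $K$ rounds; in each round $t=K+1,\dots,T$ it pulls an arm $i$ minimising $$\alpha\,T_i(t-1)\,\hat\Delta_i(t-1)^2+\tfrac12\ln T_i(t-1)$$ (ties broken arbitrarily); after $T$ rounds it outputs $d_i=1$ if $\hat\theta_i(T)\ge\theta$ and $d_i=0$ otherwise. The label $d_i$ is correct if ($d_i=0\iff\theta_i<\theta$). The aggregate regret $\mathcal R^{\mathrm{LSA}}(T)$ is the expected number of arms $i$ whose label is incorrect.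 For $x\in\mathbb R$ let $$\lambda_i(x)=\begin{cases}\exp(2x), & x\le\ln\Delta_i^{-1},\\[2pt] \dfrac{x-\ln\Delta_i^{-1}+\alpha}{\alpha\Delta_i^2}, & x>\ln\Delta_i^{-1},\end{cases}$$ where $\ln\Delta_i^{-1}=+\infty$ if $\Delta_i=0$. **Theorem.** Let $0<\alpha\le 8$ and let $T$ be an integer with $T\ge\max\{40/\alpha+1,\,40\}\cdot K$. Then the equation $$\sum_{i=1}^K\lambda_i(x)=\frac{T}{\max\{40/\alpha+1,\,40\}}$$ has a unique real solution $x=\Lambda$, and with $\lambda_i=\lambda_i(\Lambda)$, $$\mathcal R^{\mathrm{LSA}}(T)\le\Phi(\alpha)\sum_{i=1}^K\exp\!\left(-\frac{\lambda_i\Delta_i^2}{10}\right),\qquad \Phi(\alpha)=\frac{9.3\cdot 2^{1/(8\alpha)}}{2^{1/(8\alpha)}-1}\exp\!\left(\frac{2.1\,\alpha-\ln\alpha-0.5}{4\alpha}\right).$$ -/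

import Mathlib

open MeasureTheory ProbabilityTheory

noncomputable section

namespace ThresholdingBandit

/-- `X i s` is the reward of the `(s+1)`-st pull of arm `i`: all rewards are independent, and
those of arm `i` have law `ν i`. -/
structure IsRewardTable {Ω : Type*} [MeasurableSpace Ω] {K : ℕ} (P : Measure Ω)
    (ν : Fin K → Measure ℝ) (X : Fin K → ℕ → Ω → ℝ) : Prop where
  measurable : ∀ i s, Measurable (X i s)
  law : ∀ i s, P.map (X i s) = ν i
  indep : iIndepFun (fun p : Fin K × ℕ => X p.1 p.2) P

/-- The mean `θ_i` of arm `i`. -/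
def armMean {K : ℕ} (ν : Fin K → Measure ℝ) (i : Fin K) : ℝ := ∫ x, x ∂(ν i)

/-- The gap `Δ_i = |θ_i - θ|`. -/
def gap {K : ℕ} (θ : ℝ) (ν : Fin K → Measure ℝ) (i : Fin K) : ℝ := |armMean ν i - θ|

section Run

variable {Ω : Type*} {K : ℕ}

/-- `T_i(t)`: the number of pulls of arm `i` in the first `t` rounds, where `I s ω` is the arm
pulled in round `s + 1`. -/
def pullCount (I : ℕ → Ω → Fin K) (t : ℕ) (i : Fin K) (ω : Ω) : ℕ :=
  ((Finset.range t).filter (fun s => I s ω = i)).card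

/-- `θ̂_{i,n}`: the empirical mean of the first `n` rewards of arm `i`. -/
def sampleMean (X : Fin K → ℕ → Ω → ℝ) (i : Fin K) (n : ℕ) (ω : Ω) : ℝ :=
  (∑ s ∈ Finset.range n, X i s ω) / n

/-- `θ̂_i(t)`: the empirical mean of arm `i` after `t` rounds. -/
def empMean (X : Fin K → ℕ → Ω → ℝ) (I : ℕ → Ω → Fin K) (t : ℕ) (i : Fin K) (ω : Ω) : ℝ :=
  sampleMean X i (pullCount I t i ω) ω

/-- `Δ̂_i(t) = |θ̂_i(t) - θ|`: the empirical gap of arm `i` after `t` rounds. -/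
def empGap (θ : ℝ) (X : Fin K → ℕ → Ω → ℝ) (I : ℕ → Ω → Fin K) (t : ℕ) (i : Fin K) (ω : Ω) : ℝ :=
  |empMean X I t i ω - θ|

/-- The index `α T_i(t) Δ̂_i(t)² + ½ ln T_i(t)`. -/
def lsaIndex (α θ : ℝ) (X : Fin K → ℕ → Ω → ℝ) (I : ℕ → Ω → Fin K) (t : ℕ) (i : Fin K)
    (ω : Ω) : ℝ :=
  α * (pullCount I t i ω : ℝ) * empGap θ X I t i ω ^ 2
    + (1 / 2) * Real.log (pullCount I t i ω : ℝ)

/-- `I` is the sequence of arms pulled by LSA during `T` rounds: each arm is pulled once in the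
first `K` rounds (in any order), and each later round pulls a minimiser of the index (with ties
broken in any way). -/
structure IsLSARun [MeasurableSpace Ω] (α θ : ℝ) (X : Fin K → ℕ → Ω → ℝ) (T : ℕ)
    (I : ℕ → Ω → Fin K) : Prop where
  measurable : ∀ t < T, Measurable (I t)
  init : ∀ ω i, pullCount I K i ω = 1
  argmin : ∀ t, K ≤ t → t < T → ∀ ω j,
    lsaIndex α θ X I t (I t ω) ω ≤ lsaIndex α θ X I t j ω

/-- The output `d_i` of LSA: `1` if `θ̂_i(T) ≥ θ`, and `0` otherwise. -/
def lsaOutput (θ : ℝ) (X : Fin K → ℕ → Ω → ℝ) (I : ℕ → Ω → Fin K) (T : ℕ) (i : Fin K)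
    (ω : Ω) : Fin 2 :=
  if θ ≤ empMean X I T i ω then 1 else 0

/-- The event that the label `d i` is correct; the label `0` stands for `θ_i < θ`. -/
def correctEvent (θ : ℝ) (ν : Fin K → Measure ℝ) (d : Fin K → Ω → Fin 2) (i : Fin K) : Set Ω :=
  {ω | d i ω = 0 ↔ armMean ν i < θ}

/-- The aggregate regret: the expected number of incorrect labels. -/
def aggregateRegret [MeasurableSpace Ω] (P : Measure Ω) (θ : ℝ) (ν : Fin K → Measure ℝ)
    (d : Fin K → Ω → Fin 2) : ℝ :=
  ∫ ω, ∑ i, (correctEvent θ ν d i)ᶜ.indicator (fun _ => (1 : ℝ)) ω ∂P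

end Run

/-- `exp (2x)` if `x ≤ ln Δ⁻¹`, and `(x - ln Δ⁻¹ + α) / (α Δ²)` if `x > ln Δ⁻¹`, where
`ln Δ⁻¹ = +∞` for `Δ = 0`. -/
def allocation (α Δ x : ℝ) : ℝ :=
  if Δ = 0 ∨ x ≤ Real.log Δ⁻¹ then Real.exp (2 * x)
  else (x - Real.log Δ⁻¹ + α) / (α * Δ ^ 2)

/-- `max {40/α + 1, 40}`. -/
def budgetFactor (α : ℝ) : ℝ := max (40 / α + 1) 40

/-- `x` solves the equation that defines the level `Λ`. -/
def IsLevel {K : ℕ} (α : ℝ) (Δ : Fin K → ℝ) (T : ℕ) (x : ℝ) : Prop :=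
  ∑ i, allocation α (Δ i) x = T / budgetFactor α

/-- The constant `Φ(α)`. -/
def lsaConst (α : ℝ) : ℝ :=
  9.3 * (2 : ℝ) ^ (1 / (8 * α)) / ((2 : ℝ) ^ (1 / (8 * α)) - 1)
    * Real.exp ((2.1 * α - Real.log α - 0.5) / (4 * α))

end ThresholdingBandit

end

/-
Fix an arm `i` with `w = (Λ - ln Δ_i⁻¹) / 2 > 0` and the level `y = Λ - w`; if `w ≤ 0` the bound
is at least `1`. Either the indices of all arms are at least `y` in some round, or LSA always pulls
an arm whose index is below `y`, and then `T` is at most `K` plus the sum over the arms of the last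
number of pulls with index below `y`.

In the first case a wrong label of arm `i` requires either a deviation by `Δ_i` after many pulls, or
a large index after few pulls; the latter is excluded by peeling the number of pulls dyadically. In
the second case, Ville's inequality bounds the exponential moment of the last number of pulls below
`y` by that of a constant multiple of `λ_j(y)`. These numbers are independent, so Chernoff's bound
applies to their sum, and `T` exceeds `K + 3 ∑_j λ_j(Λ)` by `36 λ_j(Λ)` for every `j`. Both
probabilities are of order `exp (-w / (5 α))`.
-/

noncomputable section

namespace ThresholdingBandit

section Ville

variable {Ω : Type*} [MeasurableSpace Ω] {P : Measure Ω} {g : ℕ → Ω → ℝ}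

lemma integrable_prod_range_of_iIndepFun (hm : ∀ k, Measurable (g k)) (hind : iIndepFun g P)
    (hint : ∀ k, Integrable (g k) P) (n : ℕ) :
    Integrable (fun ω => ∏ k ∈ Finset.range n, g k ω) P := by
  have := hind.isProbabilityMeasure
  induction n with
  | zero => simp
  | succ n ih =>
    simp only [Finset.prod_range_succ]
    have h := hind.indepFun_prod_range_succ hm n
    have heq : (fun ω => ∏ k ∈ Finset.range n, g k ω) = ∏ k ∈ Finset.range n, g k := by
      ext ω; simp
    exact (heq ▸ h).integrable_mul ih (hint n)

lemma martingale_prod_range_of_iIndepFun (hm : ∀ k, Measurable (g k)) (hind : iIndepFun g P)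
    (hint : ∀ k, Integrable (g k) P) (hmean : ∀ k, P[g k] = 1) :
    Martingale (fun n ω => ∏ k ∈ Finset.range (n + 1), g k ω)
      (Filtration.natural g fun k => (hm k).stronglyMeasurable) P := by
  have := hind.isProbabilityMeasure
  have hsm : ∀ k, StronglyMeasurable (g k) := fun k => (hm k).stronglyMeasurable
  have hprod := integrable_prod_range_of_iIndepFun hm hind hint
  have hadapted : StronglyAdapted (Filtration.natural g hsm)
      fun n ω => ∏ k ∈ Finset.range (n + 1), g k ω := fun n =>
    Finset.stronglyMeasurable_fun_prod _ fun k hk =>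
      (Filtration.stronglyAdapted_natural hsm k).mono
        ((Filtration.natural g hsm).mono (Finset.mem_range_succ_iff.mp hk))
  refine martingale_nat hadapted (fun n => hprod (n + 1)) fun n => Filter.EventuallyEq.symm ?_
  calc P[fun ω => ∏ k ∈ Finset.range (n + 1 + 1), g k ω | Filtration.natural g hsm n]
      = P[(fun ω => ∏ k ∈ Finset.range (n + 1), g k ω) * g (n + 1)
          | Filtration.natural g hsm n] := by
        congr 1; ext ω; exact Finset.prod_range_succ _ _
    _ =ᵐ[P] (fun ω => ∏ k ∈ Finset.range (n + 1), g k ω)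
          * P[g (n + 1) | Filtration.natural g hsm n] := by
        refine condExp_mul_of_stronglyMeasurable_left (hadapted n) ?_ (hint _)
        convert hprod (n + 1 + 1) using 1
        ext ω; exact (Finset.prod_range_succ _ _).symm
    _ =ᵐ[P] fun ω => ∏ k ∈ Finset.range (n + 1), g k ω := by
        filter_upwards [hind.condExp_natural_ae_eq_of_lt hsm n.lt_succ_self] with ω hω
        rw [Pi.mul_apply, hω, hmean, mul_one]

lemma measure_exists_le_prod_range_le (hm : ∀ k, Measurable (g k)) (hind : iIndepFun g P)
    (hint : ∀ k, Integrable (g k) P) (hmean : ∀ k, P[g k] = 1) (hg0 : ∀ k, 0 ≤ g k) {x : ℝ}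
    (hx : 0 < x) :
    P {ω | ∃ m, x ≤ ∏ k ∈ Finset.range m, g k ω} ≤ ENNReal.ofReal x⁻¹ := by
  have := hind.isProbabilityMeasure
  rcases le_or_gt x 1 with hx1 | hx1
  · exact prob_le_one.trans (ENNReal.one_le_ofReal.mpr ((one_le_inv₀ hx).mpr hx1))
  have hM := martingale_prod_range_of_iIndepFun hm hind hint hmean
  set M : ℕ → Ω → ℝ := fun n ω => ∏ k ∈ Finset.range (n + 1), g k ω with hMdef
  have hM0 : 0 ≤ M := fun n ω => Finset.prod_nonneg fun k _ => hg0 k ω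
  have hmean_M : ∀ n, ∫ ω, M n ω ∂P = 1 := fun n => by
    rw [← setIntegral_univ, ← hM.setIntegral_eq n.zero_le MeasurableSet.univ]
    simpa [hMdef] using hmean 0
  let E : ℕ → Set Ω := fun n => {ω | x ≤ (Finset.range (n + 1)).sup' Finset.nonempty_range_add_one
    fun k => M k ω}
  have hE : ∀ n, P (E n) ≤ ENNReal.ofReal x⁻¹ := fun n => by
    have hdoob := maximal_ineq hM.submartingale hM0 (ε := x.toNNReal) n
    rw [Real.coe_toNNReal x hx.le] at hdoob
    have hle : ∫ ω in E n, M n ω ∂P ≤ 1 := (hmean_M n) ▸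
      setIntegral_le_integral (hM.integrable n) (ae_of_all _ (hM0 n))
    rw [ENNReal.ofReal_inv_of_pos hx, ENNReal.le_inv_iff_mul_le, mul_comm]
    exact hdoob.trans (ENNReal.ofReal_le_one.mpr hle)
  have hcover : {ω | ∃ m, x ≤ ∏ k ∈ Finset.range m, g k ω} ⊆ ⋃ n, E n := by
    rintro ω ⟨m, hxm⟩
    obtain ⟨n, rfl⟩ : ∃ n, m = n + 1 :=
      Nat.exists_eq_succ_of_ne_zero fun h => by simp [h, hx1.not_ge] at hxm
    exact Set.mem_iUnion.mpr ⟨n, hxm.trans (Finset.le_sup' (fun k => M k ω)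
      (Finset.self_mem_range_succ n))⟩
  have hmono : Monotone E := fun n n' hn ω (hω : x ≤ _) =>
    show x ≤ _ from hω.trans (Finset.sup'_mono _ (Finset.range_subset_range.mpr (by omega)) _)
  calc _ ≤ P (⋃ n, E n) := measure_mono hcover
    _ = ⨆ n, P (E n) := hmono.measure_iUnion
    _ ≤ _ := iSup_le hE

end Ville

section Array

variable {Ω ι κ : Type*} [MeasurableSpace Ω] {P : Measure Ω} {X : ι → κ → Ω → ℝ}

lemma iIndepFun_rows (hm : ∀ i k, Measurable (X i k))
    (hind : iIndepFun (fun p : ι × κ => X p.1 p.2) P) :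
    iIndepFun (fun i ω k => X i k ω) P := by
  have := hind.isProbabilityMeasure
  have hprob : ∀ i k, IsProbabilityMeasure (P.map (X i k)) := fun i k =>
    Measure.isProbabilityMeasure_map (hm i k).aemeasurable
  have hjoint : P.map (fun ω (p : (_ : ι) × κ) => X p.1 p.2 ω)
      = Measure.infinitePi fun p : (_ : ι) × κ => P.map (X p.1 p.2) :=
    (hind.precomp (Equiv.sigmaEquivProd ι κ).injective).map_fun_eq_infinitePi_map
      fun p => hm p.1 p.2
  have hrow : ∀ i, P.map (fun ω k => X i k ω) = Measure.infinitePi fun k => P.map (X i k) :=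
    fun i => (hind.precomp (Prod.mk_right_injective i)).map_fun_eq_infinitePi_map (hm i)
  have hcurry : (fun ω i k => X i k ω)
      = MeasurableEquiv.piCurry (fun (_ : ι) (_ : κ) => ℝ)
        ∘ fun ω (p : (_ : ι) × κ) => X p.1 p.2 ω := by
    ext; simp [Sigma.curry]
  rw [iIndepFun_iff_map_fun_eq_infinitePi_map (by fun_prop), hcurry,
    ← Measure.map_map (by fun_prop) (by fun_prop),
    hjoint, Measure.infinitePi_map_piCurry fun i k => P.map (X i k)]
  simp only [hrow]

end Array

section Moments

variable {Ω : Type*} [MeasurableSpace Ω] {P : Measure Ω} [IsProbabilityMeasure P]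

lemma integral_le_two_of_tail_le_rpow_neg_two {f : Ω → ℝ} (hf : Measurable f) (hf0 : ∀ ω, 0 ≤ f ω)
    (htail : ∀ t > 1, P {ω | t ≤ f ω} ≤ ENNReal.ofReal (t ^ (-2 : ℝ))) :
    ∫ ω, f ω ∂P ≤ 2 := by
  have hlow : ∫⁻ t in Set.Ioc (0 : ℝ) 1, P {ω | t ≤ f ω} ≤ 1 :=
    (lintegral_mono fun _ => prob_le_one).trans (by simp)
  have hhigh : ∫⁻ t in Set.Ioi (1 : ℝ), P {ω | t ≤ f ω} ≤ 1 := by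
    calc ∫⁻ t in Set.Ioi (1 : ℝ), P {ω | t ≤ f ω}
        ≤ ∫⁻ t in Set.Ioi (1 : ℝ), ENNReal.ofReal (t ^ (-2 : ℝ)) :=
          setLIntegral_mono' measurableSet_Ioi htail
      _ = ENNReal.ofReal (∫ t in Set.Ioi (1 : ℝ), t ^ (-2 : ℝ)) :=
          (ofReal_integral_eq_lintegral_ofReal
            (integrableOn_Ioi_rpow_of_lt (by norm_num) one_pos)
            ((ae_restrict_mem measurableSet_Ioi).mono fun t ht =>
              Real.rpow_nonneg (one_pos.trans ht).le _)).symm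
      _ = 1 := by
          rw [integral_Ioi_rpow_of_lt (by norm_num) one_pos]; norm_num
  rw [integral_eq_lintegral_of_nonneg_ae (ae_of_all _ hf0) hf.aestronglyMeasurable]
  refine ENNReal.toReal_le_of_le_ofReal zero_le_two ?_
  rw [lintegral_eq_lintegral_meas_le P (ae_of_all _ hf0) hf.aemeasurable,
    ← Set.Ioc_union_Ioi_eq_Ioi (zero_le_one (α := ℝ)),
    lintegral_union measurableSet_Ioi (Set.Ioc_disjoint_Ioi le_rfl)]
  calc _ ≤ (1 : ENNReal) + 1 := add_le_add hlow hhigh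
    _ = ENNReal.ofReal 2 := by norm_num

lemma mgf_mul_le_mgf_rpow {Y : Ω → ℝ} {p t : ℝ} (hp0 : 0 ≤ p) (hp1 : p ≤ 1)
    (hpt : Integrable (fun ω => Real.exp (p * t * Y ω)) P)
    (ht : Integrable (fun ω => Real.exp (t * Y ω)) P) :
    mgf Y P (p * t) ≤ mgf Y P t ^ p := by
  have hexp : ∀ ω, Real.exp (p * t * Y ω) = Real.exp (t * Y ω) ^ p := fun ω => by
    rw [← Real.exp_mul]; ring_nf
  simp only [mgf, hexp] at hpt ⊢
  exact (Real.concaveOn_rpow hp0 hp1).le_map_integral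
    (Real.continuous_rpow_const hp0).continuousOn isClosed_Ici
    (ae_of_all _ fun ω => (Real.exp_pos _).le) ht hpt

end Moments

section Subgaussian

open scoped NNReal

variable {Ω : Type*} [MeasurableSpace Ω] {P : Measure Ω} {Z : ℕ → Ω → ℝ} {c : ℝ≥0}

/-- A sequence of independent sub-Gaussian random variables with variance proxy `c`: the noise in
the successive rewards of one arm. -/
structure IsSubgaussianNoise (P : Measure Ω) (c : ℝ≥0) (Z : ℕ → Ω → ℝ) : Prop where
  measurable : ∀ k, Measurable (Z k)
  indep : iIndepFun Z P
  subgaussian : ∀ k, HasSubgaussianMGF (Z k) c P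

namespace IsSubgaussianNoise

lemma measure_exists_le_mul_sum_sub_le (h : IsSubgaussianNoise P c Z) (s a : ℝ) :
    P {ω | ∃ m : ℕ, a ≤ s * ∑ k ∈ Finset.range m, Z k ω - m * (c * s ^ 2 / 2)}
      ≤ ENNReal.ofReal (Real.exp (-a)) := by
  have := h.indep.isProbabilityMeasure
  have hexp : ∀ k, Integrable (fun ω => Real.exp (s * Z k ω)) P := fun k =>
    (h.subgaussian k).integrable_exp_mul s
  have hmgf : ∀ k, 0 < mgf (Z k) P s := fun k => mgf_pos (hexp k)
  have hφ : ∀ k, Measurable fun z => Real.exp (s * z) / mgf (Z k) P s := fun k => by fun_prop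
  have hville := measure_exists_le_prod_range_le (g := fun k ω => Real.exp (s * Z k ω)
      / mgf (Z k) P s) (fun k => (hφ k).comp (h.measurable k)) (h.indep.comp _ hφ)
    (fun k => (hexp k).div_const _)
    (fun k => by rw [integral_div]; exact div_self (hmgf k).ne')
    (fun k ω => div_nonneg (Real.exp_pos _).le (hmgf k).le) (Real.exp_pos a)
  rw [← Real.exp_neg] at hville
  refine (measure_mono ?_).trans hville
  rintro ω ⟨m, hm⟩
  refine ⟨m, ?_⟩
  calc Real.exp a
      ≤ Real.exp (s * ∑ k ∈ Finset.range m, Z k ω - m * (c * s ^ 2 / 2)) := Real.exp_le_exp.mpr hm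
    _ = ∏ k ∈ Finset.range m, Real.exp (s * Z k ω) / Real.exp (c * s ^ 2 / 2) := by
        simp only [← Real.exp_sub, ← Real.exp_sum, Finset.sum_sub_distrib, ← Finset.mul_sum,
          Finset.sum_const, Finset.card_range, nsmul_eq_mul]
    _ ≤ ∏ k ∈ Finset.range m, Real.exp (s * Z k ω) / mgf (Z k) P s := by
        gcongr with k
        · exact hmgf k
        · exact (h.subgaussian k).mgf_le s

lemma measure_exists_mul_sq_le_mul_sum_le (h : IsSubgaussianNoise P c Z) (δ b : ℝ) :
    P {ω | ∃ m : ℕ, b ≤ m ∧ m * δ ^ 2 ≤ δ * ∑ k ∈ Finset.range m, Z k ω}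
      ≤ ENNReal.ofReal (Real.exp (-(b * δ ^ 2 / (2 * c)))) := by
  refine (measure_mono ?_).trans
    (h.measure_exists_le_mul_sum_sub_le (δ / c) (b * δ ^ 2 / (2 * c)))
  rintro ω ⟨m, hbm, hdev⟩
  refine ⟨m, ?_⟩
  rcases eq_or_ne c 0 with rfl | hc
  · simp
  have : (0 : ℝ) < c := NNReal.coe_pos.mpr (pos_iff_ne_zero.mpr hc)
  calc b * δ ^ 2 / (2 * c) ≤ m * δ ^ 2 / (2 * c) := by gcongr
    _ = m * δ ^ 2 / c - m * (c * (δ / c) ^ 2 / 2) := by field_simp; ring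
    _ ≤ (δ * ∑ k ∈ Finset.range m, Z k ω) / c - m * (c * (δ / c) ^ 2 / 2) := by gcongr
    _ = δ / c * ∑ k ∈ Finset.range m, Z k ω - m * (c * (δ / c) ^ 2 / 2) := by ring

lemma measure_exists_mul_le_abs_sum_le (h : IsSubgaussianNoise P c Z) {δ : ℝ} (hδ : 0 ≤ δ)
    (b : ℝ) :
    P {ω | ∃ m : ℕ, b ≤ m ∧ m * δ ≤ |∑ k ∈ Finset.range m, Z k ω|}
      ≤ ENNReal.ofReal (2 * Real.exp (-(b * δ ^ 2 / (2 * c)))) := by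
  have hpos := h.measure_exists_mul_sq_le_mul_sum_le δ b
  have hneg := h.measure_exists_mul_sq_le_mul_sum_le (-δ) b
  rw [neg_sq] at hneg
  rw [two_mul, ENNReal.ofReal_add (Real.exp_pos _).le (Real.exp_pos _).le]
  refine (measure_mono ?_).trans ((measure_union_le _ _).trans (add_le_add hpos hneg))
  rintro ω ⟨m, hbm, hdev⟩
  rcases le_abs.mp hdev with hdev | hdev
  · exact Or.inl ⟨m, hbm, by nlinarith⟩
  · exact Or.inr ⟨m, hbm, by nlinarith⟩

end IsSubgaussianNoise

lemma isSubgaussianNoise_sub_mean [IsProbabilityMeasure P] {X : ℕ → Ω → ℝ}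
    (hm : ∀ k, Measurable (X k)) (hind : iIndepFun X P)
    (hbdd : ∀ k, ∀ᵐ ω ∂P, X k ω ∈ Set.Icc (0 : ℝ) 1) {x : ℝ} (hmean : ∀ k, P[X k] = x) :
    IsSubgaussianNoise P (1 / 4) fun k ω => X k ω - x where
  measurable k := (hm k).sub_const x
  indep := hind.comp (fun _ z => z - x) fun _ => measurable_id.sub_const x
  subgaussian k := by
    have hsub := hasSubgaussianMGF_of_mem_Icc (hm k).aemeasurable (hbdd k)
    rw [hmean k] at hsub
    convert hsub using 1
    norm_num

end Subgaussian

section Index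

variable {Ω : Type*} {Z : ℕ → Ω → ℝ} {α μ y : ℝ} {m : ℕ} {ω : Ω}

/-- The index of an arm after `m` pulls, when its mean exceeds the threshold by `μ` (of either
sign) and its rewards deviate from their mean by `Z 0, Z 1, …`; it is `0` for `m = 0`. -/
def noiseIndex (α μ : ℝ) (Z : ℕ → Ω → ℝ) (m : ℕ) (ω : Ω) : ℝ :=
  α * m * (μ + (∑ k ∈ Finset.range m, Z k ω) / m) ^ 2 + 1 / 2 * Real.log m

lemma mul_sq_le_of_le_noiseIndex {R : ℝ} (hα : 0 < α) (hμ : μ ≠ 0) (hR : 0 < R) (hm : 0 < m)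
    (hmR : (m : ℝ) ≤ R / |μ| ^ 2) (hy : y ≤ noiseIndex α μ Z m ω) :
    (y + Real.log |μ| - 1 / 2 * Real.log R) * |μ| ^ 2
      ≤ α * R * (μ + (∑ k ∈ Finset.range m, Z k ω) / m) ^ 2 := by
  have : 0 < |μ| := abs_pos.mpr hμ
  have hm0 : (0 : ℝ) < m := Nat.cast_pos.mpr hm
  unfold noiseIndex at hy
  set e := μ + (∑ k ∈ Finset.range m, Z k ω) / m
  have hlog : Real.log m ≤ Real.log R - 2 * Real.log |μ| := by
    have := Real.log_le_log hm0 hmR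
    rwa [Real.log_div hR.ne' (by positivity), Real.log_pow] at this
  calc (y + Real.log |μ| - 1 / 2 * Real.log R) * |μ| ^ 2 ≤ α * m * e ^ 2 * |μ| ^ 2 := by
        gcongr; linarith
    _ = α * (m * |μ| ^ 2) * e ^ 2 := by ring
    _ ≤ α * R * e ^ 2 := by gcongr; exact (le_div_iff₀ (by positivity)).mp hmR

lemma mul_le_abs_sum_of_le_noiseIndex {R ρ : ℝ} (hα : 0 < α) (hμ : μ ≠ 0) (hR : 0 < R)
    (hm : 0 < m) (hmR : (m : ℝ) ≤ R / |μ| ^ 2)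
    (hρ : α * R * ρ ^ 2 ≤ y + Real.log |μ| - 1 / 2 * Real.log R) (hy : y ≤ noiseIndex α μ Z m ω) :
    m * ((ρ - 1) * |μ|) ≤ |∑ k ∈ Finset.range m, Z k ω| := by
  have : (0 : ℝ) < m := Nat.cast_pos.mpr hm
  set d := (∑ k ∈ Finset.range m, Z k ω) / m with hd
  have hindex : (ρ * |μ|) ^ 2 ≤ (μ + d) ^ 2 := by
    refine le_of_mul_le_mul_left ?_ (mul_pos hα hR)
    calc α * R * (ρ * |μ|) ^ 2 = α * R * ρ ^ 2 * |μ| ^ 2 := by ring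
      _ ≤ (y + Real.log |μ| - 1 / 2 * Real.log R) * |μ| ^ 2 := by gcongr
      _ ≤ α * R * (μ + d) ^ 2 := mul_sq_le_of_le_noiseIndex hα hμ hR hm hmR hy
  have habs : ρ * |μ| ≤ |μ| + |d| :=
    ((le_abs_self _).trans (sq_le_sq.mp hindex)).trans (abs_add_le μ d)
  have hsum : |∑ k ∈ Finset.range m, Z k ω| = m * |d| := by
    rw [hd, abs_div, Nat.abs_cast]; field_simp
  rw [hsum]
  gcongr
  linarith

lemma mul_sq_sub_le_of_noiseIndex_lt (hα : 0 < α) (hm : 1 < m * |μ| ^ 2)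
    (hy : noiseIndex α μ Z m ω < y) :
    m * |μ| ^ 2 - 2 * ((y + Real.log |μ|) / α)
      ≤ -2 * μ * ∑ k ∈ Finset.range m, Z k ω - m * ((1 / 4) * (-2 * μ) ^ 2 / 2) := by
  have hΔ : 0 < |μ| := (abs_nonneg μ).lt_of_ne' fun h => by norm_num [h] at hm
  have hm0 : (0 : ℝ) < m := pos_of_mul_pos_left (one_pos.trans hm) (sq_nonneg _)
  unfold noiseIndex at hy
  set e := μ + (∑ k ∈ Finset.range m, Z k ω) / m with he
  have hsum : ∑ k ∈ Finset.range m, Z k ω = m * (e - μ) := by rw [he]; field_simp; ring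
  have hlog : 0 ≤ Real.log m + 2 * Real.log |μ| := by
    have := Real.log_nonneg hm.le
    rwa [Real.log_mul hm0.ne' (by positivity), Real.log_pow] at this
  have hsmall : m * e ^ 2 ≤ (y + Real.log |μ|) / α := by
    rw [le_div_iff₀ hα]; linarith
  rw [hsum, sq_abs]
  linarith [mul_nonneg hm0.le (sq_nonneg (μ - 2 * e))]

variable [MeasurableSpace Ω] {P : Measure Ω}

lemma measurable_noiseIndex (hZ : ∀ k, Measurable (Z k)) (α μ : ℝ) (m : ℕ) :
    Measurable (noiseIndex α μ Z m) := by
  unfold noiseIndex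
  fun_prop

lemma exists_one_le_mul_sq_eq {R b : ℝ} (hR : 0 < R) (hb : 2 * R ≤ b) :
    ∃ ρ : ℝ, 1 ≤ ρ ∧ R * ρ ^ 2 = b ∧ b / 2 - R ≤ R * (ρ - 1) ^ 2 := by
  have hsq : R * √(b / R) ^ 2 = b := by
    rw [Real.sq_sqrt (div_nonneg (by linarith) hR.le)]; field_simp
  refine ⟨√(b / R), ?_, hsq, ?_⟩
  · rw [Real.one_le_sqrt, le_div_iff₀ hR]; linarith
  · nlinarith [mul_nonneg hR.le (sq_nonneg (√(b / R) - 2))]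

lemma measure_exists_le_noiseIndex_dyadic_le (h : IsSubgaussianNoise P (1 / 4) Z) (hα : 0 < α)
    (hμ : μ ≠ 0) (y : ℝ) {R : ℝ} (hR : 0 < R) :
    P {ω | ∃ m : ℕ, R / (2 * |μ| ^ 2) ≤ m ∧ m ≤ R / |μ| ^ 2 ∧ y ≤ noiseIndex α μ Z m ω}
      ≤ ENNReal.ofReal
        (2 * Real.exp (R - (y + Real.log |μ| - 1 / 2 * Real.log R) / (2 * α))) := by
  have := h.indep.isProbabilityMeasure
  have hΔ : 0 < |μ| := abs_pos.mpr hμ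
  set a := y + Real.log |μ| - 1 / 2 * Real.log R
  rcases le_or_gt (a / (2 * α)) R with haR | haR
  · refine prob_le_one.trans (ENNReal.one_le_ofReal.mpr ?_)
    linarith [Real.one_le_exp (sub_nonneg.mpr haR)]
  have hhalf : a / (2 * α) = a / α / 2 := by rw [div_div, mul_comm 2]
  obtain ⟨ρ, hρ_one, hρ_sq, hρ_rate⟩ := exists_one_le_mul_sq_eq hR (b := a / α) (by linarith)
  have hrate : -(R / (2 * |μ| ^ 2) * ((ρ - 1) * |μ|) ^ 2 / (2 * (1 / 4 : NNReal)))
      ≤ R - a / (2 * α) := by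
    have : R / (2 * |μ| ^ 2) * ((ρ - 1) * |μ|) ^ 2 / (2 * (1 / 4 : NNReal))
        = R * (ρ - 1) ^ 2 := by
      push_cast; field_simp; ring
    linarith
  refine (measure_mono ?_).trans ((h.measure_exists_mul_le_abs_sum_le
    (mul_nonneg (sub_nonneg.mpr hρ_one) hΔ.le) (R / (2 * |μ| ^ 2))).trans
    (ENNReal.ofReal_le_ofReal (by gcongr)))
  rintro ω ⟨m, hlow, hhigh, hy⟩
  have hm : (0 : ℝ) < m := lt_of_lt_of_le (by positivity) hlow
  have hρα : α * R * ρ ^ 2 = a := by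
    rw [eq_div_iff hα.ne'] at hρ_sq; linarith
  exact ⟨m, hlow, mul_le_abs_sum_of_le_noiseIndex hα hμ hR (Nat.cast_pos.mp hm) hhigh hρα.le hy⟩

lemma exists_dyadic_range {x r : ℝ} (hx : 0 < x) (hxr : x ≤ r) :
    ∃ k : ℕ, r * (1 / 2) ^ k ≤ 2 * x ∧ x ≤ r * (1 / 2) ^ k := by
  have hr : 0 < r := hx.trans_le hxr
  obtain ⟨k, hlow, hhigh⟩ := exists_nat_pow_near_of_lt_one (x := x / r) (y := 1 / 2)
    (by positivity) ((div_le_one hr).mpr hxr) (by norm_num) (by norm_num)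
  rw [lt_div_iff₀ hr, pow_succ] at hlow
  rw [div_le_iff₀ hr] at hhigh
  exact ⟨k, by linarith, by linarith⟩

lemma exp_dyadic_le {r : ℝ} (hα : 0 < α) (hr : 0 < r) (b : ℝ) (k : ℕ) :
    Real.exp (r * (1 / 2) ^ k - (b - 1 / 2 * Real.log (r * (1 / 2) ^ k)) / (2 * α))
      ≤ Real.exp (r - (b - 1 / 2 * Real.log r) / (2 * α))
        * Real.exp (-(Real.log 2 / (4 * α))) ^ k := by
  have hle : r * (1 / 2) ^ k ≤ r :=
    mul_le_of_le_one_right hr.le (pow_le_one₀ (by norm_num) (by norm_num))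
  have hlog : Real.log (r * (1 / 2) ^ k) = Real.log r - k * Real.log 2 := by
    rw [Real.log_mul hr.ne' (by positivity), Real.log_pow, one_div, Real.log_inv]; ring
  rw [← Real.exp_nat_mul, ← Real.exp_add, hlog]
  gcongr
  calc _ ≤ r - (b - 1 / 2 * (Real.log r - k * Real.log 2)) / (2 * α) := by gcongr
    _ = _ := by field_simp; ring

lemma measure_exists_le_noiseIndex_early_le (h : IsSubgaussianNoise P (1 / 4) Z) (hα : 0 < α)
    (hμ : μ ≠ 0) (y : ℝ) {r : ℝ} (hr : 0 < r) :
    P {ω | ∃ m : ℕ, 1 ≤ m ∧ m ≤ r / |μ| ^ 2 ∧ y ≤ noiseIndex α μ Z m ω}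
      ≤ ENNReal.ofReal
        (2 * Real.exp (r - (y + Real.log |μ| - 1 / 2 * Real.log r) / (2 * α))
          / (1 - Real.exp (-(Real.log 2 / (4 * α))))) := by
  have : 0 < |μ| := abs_pos.mpr hμ
  set C := 2 * Real.exp (r - (y + Real.log |μ| - 1 / 2 * Real.log r) / (2 * α)) with hC
  set q := Real.exp (-(Real.log 2 / (4 * α)))
  have hq_lt : q < 1 :=
    Real.exp_lt_one_iff.mpr (neg_neg_of_pos (div_pos (Real.log_pos one_lt_two) (by positivity)))
  let R : ℕ → ℝ := fun k => r * (1 / 2) ^ k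
  let A : ℕ → Set Ω := fun k =>
    {ω | ∃ m : ℕ, R k / (2 * |μ| ^ 2) ≤ m ∧ m ≤ R k / |μ| ^ 2 ∧ y ≤ noiseIndex α μ Z m ω}
  have hA : ∀ k, P (A k) ≤ ENNReal.ofReal (C * q ^ k) := fun k => by
    refine (measure_exists_le_noiseIndex_dyadic_le h hα hμ y (R := R k) (by positivity)).trans
      (ENNReal.ofReal_le_ofReal ?_)
    rw [hC, mul_assoc]
    gcongr 2 * ?_
    exact exp_dyadic_le hα hr _ k
  have hcover : {ω | ∃ m : ℕ, 1 ≤ m ∧ m ≤ r / |μ| ^ 2 ∧ y ≤ noiseIndex α μ Z m ω}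
      ⊆ ⋃ k, A k := by
    rintro ω ⟨m, hm, hmr, hy⟩
    have hm0 : (0 : ℝ) < m := Nat.cast_pos.mpr hm
    rw [le_div_iff₀ (by positivity)] at hmr
    obtain ⟨k, hlow, hhigh⟩ := exists_dyadic_range (by positivity) hmr
    refine Set.mem_iUnion.mpr ⟨k, m, ?_, ?_, hy⟩
    · rw [div_le_iff₀ (by positivity)]; linarith
    · rwa [le_div_iff₀ (by positivity)]
  have hsum : HasSum (fun k => C * q ^ k) (C / (1 - q)) :=
    (hasSum_geometric_of_lt_one (Real.exp_pos _).le hq_lt).mul_left C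
  calc _ ≤ P (⋃ k, A k) := measure_mono hcover
    _ ≤ ∑' k, P (A k) := measure_iUnion_le _
    _ ≤ ∑' k, ENNReal.ofReal (C * q ^ k) := ENNReal.tsum_le_tsum hA
    _ = ENNReal.ofReal (C / (1 - q)) := by
        rw [← ENNReal.ofReal_tsum_of_nonneg (fun k => by positivity) hsum.summable, hsum.tsum_eq]

lemma mgf_le_of_noiseIndex_lt (h : IsSubgaussianNoise P (1 / 4) Z) (hα : 0 < α)
    (hy : 0 ≤ y + Real.log |μ|) {S : Ω → ℕ} (hS : Measurable S)
    (hSy : ∀ ω, S ω = 0 ∨ noiseIndex α μ Z (S ω) ω < y) :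
    mgf (fun ω => (S ω : ℝ)) P (|μ| ^ 2 / 2)
      ≤ Real.exp (3 / 2 * ((y + Real.log |μ| + α) / α)) := by
  have := h.indep.isProbabilityMeasure
  set w := (y + Real.log |μ|) / α with hw
  have hw0 : 0 ≤ w := div_nonneg hy hα.le
  -- Ville's inequality with tilt `-2 μ` gives `f` the tail `t ^ (-2)`, because below `y`
  -- the tilted sum minus its compensator is at least twice the exponent of `f`.
  let f : Ω → ℝ := fun ω => Real.exp (|μ| ^ 2 / 2 * S ω - (1 / 2 + w))
  have hf : P[f] ≤ 2 := by
    refine integral_le_two_of_tail_le_rpow_neg_two (by fun_prop) (fun ω => (Real.exp_pos _).le)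
      fun t ht => ?_
    have ht0 : 0 < t := one_pos.trans ht
    rw [Real.rpow_def_of_pos ht0, mul_neg]
    refine (measure_mono ?_).trans
      (h.measure_exists_le_mul_sum_sub_le (-2 * μ) (Real.log t * 2))
    intro ω hω
    refine ⟨S ω, ?_⟩
    have hlog : Real.log t ≤ |μ| ^ 2 / 2 * S ω - (1 / 2 + w) := (Real.log_le_iff_le_exp ht0).mpr hω
    have hlarge : 1 < S ω * |μ| ^ 2 := by linarith [Real.log_pos ht]
    have hSω : S ω ≠ 0 := fun h0 => by norm_num [h0] at hlarge
    have hcross := mul_sq_sub_le_of_noiseIndex_lt hα hlarge ((hSy ω).resolve_left hSω)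
    push_cast
    linarith
  calc mgf (fun ω => (S ω : ℝ)) P (|μ| ^ 2 / 2) = Real.exp (1 / 2 + w) * P[f] := by
        rw [mgf, ← integral_const_mul]
        congr 1 with ω
        rw [← Real.exp_add, add_sub_cancel]
    _ ≤ Real.exp (1 / 2 + w) * Real.exp 1 := by
        gcongr; exact hf.trans (by linarith [Real.add_one_le_exp 1])
    _ ≤ Real.exp (3 / 2 * ((y + Real.log |μ| + α) / α)) := by
        rw [← Real.exp_add, add_div, ← hw, div_self hα.ne']
        gcongr
        linarith

lemma integrable_exp_mul_of_le [IsFiniteMeasure P] {S : Ω → ℕ} (hS : Measurable S) {N : ℕ}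
    (hSN : ∀ ω, S ω ≤ N) (t : ℝ) : Integrable (fun ω => Real.exp (t * S ω)) P :=
  integrable_exp_mul_of_mem_Icc (a := 0) (b := N) (by fun_prop)
    (ae_of_all _ fun ω => ⟨Nat.cast_nonneg _, Nat.cast_le.mpr (hSN ω)⟩)

lemma mgf_le_of_noiseIndex_lt_of_le (h : IsSubgaussianNoise P (1 / 4) Z) (hα : 0 < α)
    (hμ : μ ≠ 0) (hy : 0 ≤ y + Real.log |μ|) {S : Ω → ℕ} (hS : Measurable S) {N : ℕ}
    (hSN : ∀ ω, S ω ≤ N) (hSy : ∀ ω, S ω = 0 ∨ noiseIndex α μ Z (S ω) ω < y) {τ : ℝ}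
    (hτ0 : 0 ≤ τ) (hτ : τ ≤ |μ| ^ 2 / 2) :
    mgf (fun ω => (S ω : ℝ)) P τ
      ≤ Real.exp (3 * τ * ((y + Real.log |μ| + α) / (α * |μ| ^ 2))) := by
  have := h.indep.isProbabilityMeasure
  have : 0 < |μ| := abs_pos.mpr hμ
  set p := τ / (|μ| ^ 2 / 2) with hp
  have hp0 : 0 ≤ p := by positivity
  have hp1 : p ≤ 1 := (div_le_one (by positivity)).mpr hτ
  have hτp : τ = p * (|μ| ^ 2 / 2) := by rw [hp]; field_simp
  calc mgf (fun ω => (S ω : ℝ)) P τ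
      ≤ mgf (fun ω => (S ω : ℝ)) P (|μ| ^ 2 / 2) ^ p := by
        rw [hτp]
        exact mgf_mul_le_mgf_rpow hp0 hp1 (integrable_exp_mul_of_le hS hSN _)
          (integrable_exp_mul_of_le hS hSN _)
    _ ≤ Real.exp (3 / 2 * ((y + Real.log |μ| + α) / α)) ^ p := by
        gcongr
        · exact mgf_nonneg
        · exact mgf_le_of_noiseIndex_lt h hα hy hS hSy
    _ = Real.exp (3 * τ * ((y + Real.log |μ| + α) / (α * |μ| ^ 2))) := by
        rw [← Real.exp_mul, hp]
        congr 1
        field_simp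

end Index

section Allocation

variable {α Δ x y : ℝ}

lemma allocation_of_low (h : Δ = 0 ∨ x + Real.log Δ ≤ 0) :
    allocation α Δ x = Real.exp (2 * x) := by
  refine if_pos (h.imp_right fun h => ?_)
  rw [Real.log_inv]
  linarith

lemma allocation_of_high (hΔ : Δ ≠ 0) (h : 0 < x + Real.log Δ) :
    allocation α Δ x = (x + Real.log Δ + α) / (α * Δ ^ 2) := by
  rw [allocation, if_neg, Real.log_inv, sub_neg_eq_add]
  rw [Real.log_inv, not_or]
  exact ⟨hΔ, by linarith⟩

lemma exp_neg_two_mul_log (hΔ : 0 < Δ) : Real.exp (-(2 * Real.log Δ)) = (Δ ^ 2)⁻¹ := by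
  rw [Real.exp_neg, mul_comm, Real.exp_mul, Real.exp_log hΔ, Real.rpow_two]

lemma exp_two_mul_eq (hΔ : 0 < Δ) (x : ℝ) :
    Real.exp (2 * x) = Real.exp (2 * (x + Real.log Δ)) / Δ ^ 2 := by
  rw [div_eq_mul_inv, ← exp_neg_two_mul_log hΔ, ← Real.exp_add]
  ring_nf

lemma continuous_allocation (hα : 0 < α) (hΔ : 0 ≤ Δ) : Continuous (allocation α Δ) := by
  rcases hΔ.eq_or_lt with rfl | hΔ
  · rw [show allocation α 0 = fun x => Real.exp (2 * x) from
      funext fun x => allocation_of_low (Or.inl rfl)]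
    fun_prop
  · have hpiecewise : allocation α Δ = fun x => if x ≤ -Real.log Δ then Real.exp (2 * x)
        else (x + Real.log Δ + α) / (α * Δ ^ 2) := by
      ext x
      split_ifs with h
      · exact allocation_of_low (Or.inr (by linarith))
      · exact allocation_of_high hΔ.ne' (by linarith)
    rw [hpiecewise]
    refine Continuous.if_le (by fun_prop) (by fun_prop) continuous_id continuous_const ?_
    rintro x rfl
    rw [exp_two_mul_eq hΔ, neg_add_cancel, mul_zero, Real.exp_zero]
    field_simp
    ring

lemma strictMono_allocation (hα : 0 < α) (hΔ : 0 ≤ Δ) : StrictMono (allocation α Δ) := by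
  intro x x' hx
  have hexp : Real.exp (2 * x) < Real.exp (2 * x') := by gcongr
  rcases hΔ.eq_or_lt with rfl | hΔ
  · rwa [allocation_of_low (Or.inl rfl), allocation_of_low (Or.inl rfl)]
  rcases le_or_gt (x' + Real.log Δ) 0 with h' | h'
  · rwa [allocation_of_low (Or.inr h'), allocation_of_low (Or.inr (by linarith))]
  rw [allocation_of_high hΔ.ne' h']
  rcases le_or_gt (x + Real.log Δ) 0 with h | h
  · rw [allocation_of_low (Or.inr h), exp_two_mul_eq hΔ]
    calc _ ≤ 1 / Δ ^ 2 := by gcongr; exact Real.exp_le_one_iff.mpr (by linarith)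
      _ = α / (α * Δ ^ 2) := by field_simp
      _ < _ := by gcongr; linarith
  · rw [allocation_of_high hΔ.ne' h]
    gcongr

lemma allocation_zero (hΔ : Δ ∈ Set.Icc (0 : ℝ) 1) : allocation α Δ 0 = 1 := by
  rw [allocation_of_low (Or.inr (by simpa using Real.log_nonpos hΔ.1 hΔ.2)), mul_zero,
    Real.exp_zero]

lemma one_le_allocation (hα : 0 < α) (hΔ : Δ ∈ Set.Icc (0 : ℝ) 1) (hx : 0 ≤ x) :
    1 ≤ allocation α Δ x := by
  rw [← allocation_zero (α := α) hΔ]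
  exact (strictMono_allocation hα hΔ.1).monotone hx

lemma allocation_mul_sq_le_one (hΔ : 0 ≤ Δ) (h : Δ = 0 ∨ x + Real.log Δ ≤ 0) :
    allocation α Δ x * Δ ^ 2 ≤ 1 := by
  rcases hΔ.eq_or_lt with rfl | hΔ
  · simp
  · have hx := h.resolve_left hΔ.ne'
    rw [allocation_of_low h, exp_two_mul_eq hΔ, div_mul_cancel₀ _ (by positivity)]
    exact Real.exp_le_one_iff.mpr (by linarith)

lemma sub_add_log_le_mul_allocation (hα : 0 < α) (hΔ : 0 ≤ Δ) (hyx : y ≤ x) :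
    x - y + Real.log α + 1
      ≤ α * (max (Real.exp (-(2 * y))) (Δ ^ 2) * allocation α Δ x) := by
  have hexp : ∀ z, Real.log α + z + 1 ≤ α * Real.exp z := fun z => by
    simpa [Real.exp_add, Real.exp_log hα] using Real.add_one_le_exp (Real.log α + z)
  by_cases hlow : Δ = 0 ∨ x + Real.log Δ ≤ 0
  · rw [allocation_of_low hlow]
    calc x - y + Real.log α + 1 ≤ α * Real.exp (2 * (x - y)) := by linarith [hexp (2 * (x - y))]
      _ = α * (Real.exp (-(2 * y)) * Real.exp (2 * x)) := by rw [← Real.exp_add]; ring_nf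
      _ ≤ _ := by gcongr; exact le_max_left _ _
  rw [not_or, not_le] at hlow
  have hΔ0 : 0 < Δ := hΔ.lt_of_ne' hlow.1
  rw [allocation_of_high hlow.1 hlow.2]
  set v := x + Real.log Δ with hv
  have hv0 : 0 < v := hlow.2
  rcases le_or_gt (x - y) v with hsmall | hlarge
  · calc x - y + Real.log α + 1 ≤ v + α := by linarith [Real.log_le_sub_one_of_pos hα]
      _ = α * (Δ ^ 2 * ((v + α) / (α * Δ ^ 2))) := by field_simp
      _ ≤ _ := by gcongr; exact le_max_right _ _
  · have hone : 1 ≤ Real.exp (2 * (x - y - v)) := Real.one_le_exp (by linarith)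
    have hfactor : Real.exp (-(2 * y)) = Δ ^ 2 * Real.exp (2 * (x - y - v)) := by
      rw [show 2 * (x - y - v) = -(2 * y) + -(2 * Real.log Δ) by rw [hv]; ring, Real.exp_add,
        exp_neg_two_mul_log hΔ0]
      field_simp
    calc x - y + Real.log α + 1 ≤ v + α * Real.exp (2 * (x - y - v)) := by
          linarith [hexp (2 * (x - y - v))]
      _ ≤ Real.exp (2 * (x - y - v)) * (v + α) := by
          linarith [mul_le_mul_of_nonneg_right hone hv0.le]
      _ = α * (Real.exp (-(2 * y)) * ((v + α) / (α * Δ ^ 2))) := by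
          rw [hfactor]; field_simp
      _ ≤ _ := by gcongr; exact le_max_left _ _

lemma exists_le_allocation (hα : 0 < α) (hΔ : Δ ∈ Set.Icc (0 : ℝ) 1) (b : ℝ) :
    ∃ x, 0 ≤ x ∧ b ≤ allocation α Δ x := by
  refine ⟨max 0 (α * b - Real.log α - 1), le_max_left _ _, le_of_mul_le_mul_left ?_ hα⟩
  have hgrowth := sub_add_log_le_mul_allocation (y := 0) hα hΔ.1
    (le_max_left 0 (α * b - Real.log α - 1))
  rw [mul_zero, neg_zero, Real.exp_zero, max_eq_left (pow_le_one₀ hΔ.1 hΔ.2), one_mul] at hgrowth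
  linarith [le_max_right 0 (α * b - Real.log α - 1)]

lemma strictMono_sum_allocation {ι : Type*} [Fintype ι] [Nonempty ι] {Δ : ι → ℝ} (hα : 0 < α)
    (hΔ : ∀ i, 0 ≤ Δ i) : StrictMono fun x => ∑ i, allocation α (Δ i) x := fun _ _ hx =>
  Finset.sum_lt_sum_of_nonempty Finset.univ_nonempty fun i _ => strictMono_allocation hα (hΔ i) hx

end Allocation

section Level

variable {α Λ : ℝ} {K T : ℕ} {Δ : Fin K → ℝ}

lemma budgetFactor_pos (α : ℝ) : 0 < budgetFactor α :=
  lt_of_lt_of_le (by norm_num) (le_max_right (40 / α + 1) 40)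

lemma sum_allocation_zero_le (hΔ : ∀ i, Δ i ∈ Set.Icc (0 : ℝ) 1) (hT : budgetFactor α * K ≤ T) :
    ∑ i, allocation α (Δ i) 0 ≤ T / budgetFactor α := by
  rw [le_div_iff₀ (budgetFactor_pos α)]
  simpa [fun i => allocation_zero (α := α) (hΔ i), mul_comm] using hT

lemma existsUnique_isLevel (hK : 0 < K) (hα : 0 < α) (hΔ : ∀ i, Δ i ∈ Set.Icc (0 : ℝ) 1)
    (hT : budgetFactor α * K ≤ T) : ∃! x, IsLevel α Δ T x := by
  have : Nonempty (Fin K) := ⟨⟨0, hK⟩⟩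
  have hcont : Continuous fun x => ∑ i, allocation α (Δ i) x :=
    continuous_finsetSum _ fun i _ => continuous_allocation hα (hΔ i).1
  obtain ⟨x₁, hx₁, hle⟩ := exists_le_allocation hα (hΔ ⟨0, hK⟩) (T / budgetFactor α)
  have hup : T / budgetFactor α ≤ ∑ i, allocation α (Δ i) x₁ := hle.trans <|
    Finset.single_le_sum (f := fun i => allocation α (Δ i) x₁)
      (fun i _ => zero_le_one.trans (one_le_allocation hα (hΔ i) hx₁)) (Finset.mem_univ _)
  obtain ⟨x, -, hx⟩ := intermediate_value_Icc hx₁ hcont.continuousOn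
    ⟨sum_allocation_zero_le hΔ hT, hup⟩
  exact ⟨x, hx, fun x' hx' =>
    (strictMono_sum_allocation hα fun i => (hΔ i).1).injective (hx'.trans hx.symm)⟩

namespace IsLevel

lemma nonneg (hΛ : IsLevel α Δ T Λ) (hK : 0 < K) (hα : 0 < α) (hΔ : ∀ i, Δ i ∈ Set.Icc (0 : ℝ) 1)
    (hT : budgetFactor α * K ≤ T) : 0 ≤ Λ := by
  have : Nonempty (Fin K) := ⟨⟨0, hK⟩⟩
  exact (strictMono_sum_allocation hα fun i => (hΔ i).1).le_iff_le.mp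
    ((sum_allocation_zero_le hΔ hT).trans_eq (Eq.symm hΛ))

lemma thirtySix_mul_allocation_le_sub (hΛ : IsLevel α Δ T Λ) (hα : 0 < α)
    (hΔ : ∀ i, Δ i ∈ Set.Icc (0 : ℝ) 1) (hΛ0 : 0 ≤ Λ) (i : Fin K) :
    36 * allocation α (Δ i) Λ ≤ T - K - 3 * ∑ j, allocation α (Δ j) Λ := by
  have hone : ∀ j, 1 ≤ allocation α (Δ j) Λ := fun j => one_le_allocation hα (hΔ j) hΛ0
  have hsingle : allocation α (Δ i) Λ ≤ ∑ j, allocation α (Δ j) Λ :=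
    Finset.single_le_sum (f := fun j => allocation α (Δ j) Λ)
      (fun j _ => zero_le_one.trans (hone j)) (Finset.mem_univ i)
  have hcard : (K : ℝ) ≤ ∑ j, allocation α (Δ j) Λ := by
    simpa using Finset.card_nsmul_le_sum Finset.univ _ 1 fun j _ => hone j
  have hbudget : (T : ℝ) = (∑ j, allocation α (Δ j) Λ) * budgetFactor α :=
    (div_eq_iff (budgetFactor_pos α).ne').mp (Eq.symm hΛ)
  have hforty : (∑ j, allocation α (Δ j) Λ) * 40 ≤ T := by
    rw [hbudget]
    exact mul_le_mul_of_nonneg_left (le_max_right _ _) ((Nat.cast_nonneg K).trans hcard)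
  linarith

end IsLevel

end Level

section LastBelow

variable {Ω : Type*} {Z : ℕ → Ω → ℝ} {α μ y : ℝ} {N : ℕ} {ω : Ω}

/-- The largest number of pulls `m ≤ N` after which the index of an arm is below the level `y`; it
is `0` if there is no such `m`. -/
def lastBelow (α μ : ℝ) (Z : ℕ → Ω → ℝ) (y : ℝ) (N : ℕ) (ω : Ω) : ℕ :=
  Nat.findGreatest (fun m => noiseIndex α μ Z m ω < y) N

lemma lastBelow_eq_zero_or_noiseIndex_lt (ω : Ω) :
    lastBelow α μ Z y N ω = 0 ∨ noiseIndex α μ Z (lastBelow α μ Z y N ω) ω < y :=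
  or_iff_not_imp_left.mpr (Nat.findGreatest_of_ne_zero rfl)

lemma le_lastBelow {m : ℕ} (hmN : m ≤ N) (hm : m = 0 ∨ noiseIndex α μ Z m ω < y) :
    m ≤ lastBelow α μ Z y N ω :=
  hm.elim (fun h => h.trans_le (Nat.zero_le _)) fun h => Nat.le_findGreatest hmN h

lemma lastBelow_le_exp (hα : 0 ≤ α) (ω : Ω) :
    (lastBelow α μ Z y N ω : ℝ) ≤ Real.exp (2 * y) := by
  rcases (lastBelow α μ Z y N ω).eq_zero_or_pos with h0 | hpos
  · rw [h0, Nat.cast_zero]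
    exact (Real.exp_pos _).le
  · have hlt := (lastBelow_eq_zero_or_noiseIndex_lt ω).resolve_left hpos.ne'
    have hlog : 1 / 2 * Real.log (lastBelow α μ Z y N ω) ≤ y :=
      (le_add_of_nonneg_left (by positivity)).trans hlt.le
    exact (Real.log_le_iff_le_exp (Nat.cast_pos.mpr hpos)).mp (by linarith)

variable [MeasurableSpace Ω] {P : Measure Ω}

lemma measurable_lastBelow (hZ : ∀ k, Measurable (Z k)) (α μ y : ℝ) (N : ℕ) :
    Measurable (lastBelow α μ Z y N) :=
  measurable_findGreatest fun m _ =>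
    measurableSet_lt (measurable_noiseIndex hZ α μ m) measurable_const

lemma integrable_exp_mul_lastBelow [IsFiniteMeasure P] (hZ : ∀ k, Measurable (Z k))
    (α μ y : ℝ) (N : ℕ) (t : ℝ) :
    Integrable (fun ω => Real.exp (t * lastBelow α μ Z y N ω)) P :=
  integrable_exp_mul_of_le (measurable_lastBelow hZ α μ y N) (fun _ => Nat.findGreatest_le N) t

lemma mgf_lastBelow_le (h : IsSubgaussianNoise P (1 / 4) Z) (hα : 0 < α) {τ : ℝ} (hτ0 : 0 ≤ τ)
    (hτ : τ ≤ max (Real.exp (-(2 * y))) (|μ| ^ 2) / 2) :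
    mgf (fun ω => (lastBelow α μ Z y N ω : ℝ)) P τ
      ≤ Real.exp (3 * τ * allocation α |μ| y) := by
  have := h.indep.isProbabilityMeasure
  by_cases hlow : |μ| = 0 ∨ y + Real.log |μ| ≤ 0
  · rw [allocation_of_low hlow]
    calc mgf (fun ω => (lastBelow α μ Z y N ω : ℝ)) P τ
        ≤ ∫ _, Real.exp (3 * τ * Real.exp (2 * y)) ∂P := by
          refine integral_mono (integrable_exp_mul_lastBelow h.measurable α μ y N τ)
            (integrable_const _) fun ω => Real.exp_le_exp.mpr ?_
          calc τ * lastBelow α μ Z y N ω ≤ τ * Real.exp (2 * y) := by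
                gcongr; exact lastBelow_le_exp hα.le ω
            _ ≤ 3 * τ * Real.exp (2 * y) := by gcongr; linarith
      _ = _ := by simp
  · rw [not_or, not_le] at hlow
    have hμ : 0 < |μ| := (abs_nonneg μ).lt_of_ne' hlow.1
    have hexp : Real.exp (-(2 * y)) ≤ |μ| ^ 2 := by
      rw [← inv_inv (|μ| ^ 2), ← exp_neg_two_mul_log hμ, Real.exp_neg]
      gcongr
      linarith [hlow.2]
    rw [max_eq_right hexp] at hτ
    rw [allocation_of_high hlow.1 hlow.2]
    exact mgf_le_of_noiseIndex_lt_of_le h hα (abs_pos.mp hμ) hlow.2.le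
      (measurable_lastBelow h.measurable α μ y N) (fun _ => Nat.findGreatest_le N)
      lastBelow_eq_zero_or_noiseIndex_lt hτ0 hτ

end LastBelow

section Noise

variable {Ω : Type*} {K : ℕ} {ν : Fin K → Measure ℝ} {X : Fin K → ℕ → Ω → ℝ} {α θ : ℝ}
  {I : ℕ → Ω → Fin K} {T : ℕ} {i : Fin K} {ω : Ω}

/-- The deviation of the reward of the `(k+1)`-st pull of arm `i` from the mean of that arm. -/
def rewardNoise (ν : Fin K → Measure ℝ) (X : Fin K → ℕ → Ω → ℝ) (i : Fin K) (k : ℕ) (ω : Ω) : ℝ :=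
  X i k ω - armMean ν i

lemma sampleMean_sub_eq {m : ℕ} (hm : m ≠ 0) (i : Fin K) (ω : Ω) :
    sampleMean X i m ω - θ
      = armMean ν i - θ + (∑ k ∈ Finset.range m, rewardNoise ν X i k ω) / m := by
  simp only [sampleMean, rewardNoise, Finset.sum_sub_distrib, Finset.sum_const, Finset.card_range,
    nsmul_eq_mul]
  field_simp
  ring

lemma lsaIndex_eq_noiseIndex (ν : Fin K → Measure ℝ) (t : ℕ) (i : Fin K) (ω : Ω) :
    lsaIndex α θ X I t i ω
      = noiseIndex α (armMean ν i - θ) (rewardNoise ν X i) (pullCount I t i ω) ω := by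
  rcases eq_or_ne (pullCount I t i ω) 0 with h0 | h0
  · simp [lsaIndex, noiseIndex, h0]
  · rw [lsaIndex, noiseIndex, empGap, empMean, sq_abs, sampleMean_sub_eq h0]

lemma mul_sq_le_of_notMem_correctEvent (h : ω ∉ correctEvent θ ν (lsaOutput θ X I T) i)
    (hT : pullCount I T i ω ≠ 0) :
    pullCount I T i ω * (-(armMean ν i - θ)) ^ 2
      ≤ -(armMean ν i - θ)
        * ∑ k ∈ Finset.range (pullCount I T i ω), rewardNoise ν X i k ω := by
  have hopposite : (armMean ν i - θ) * (empMean X I T i ω - θ) ≤ 0 := by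
    have hlabel : ¬(lsaOutput θ X I T i ω = 0 ↔ armMean ν i < θ) := h
    by_cases hle : θ ≤ empMean X I T i ω
    · have hlt : armMean ν i < θ := by simpa [lsaOutput, hle] using hlabel
      exact mul_nonpos_of_nonpos_of_nonneg (by linarith) (by linarith)
    · have hge : θ ≤ armMean ν i := by simpa [lsaOutput, hle] using hlabel
      exact mul_nonpos_of_nonneg_of_nonpos (by linarith) (by linarith)
  rw [empMean, sampleMean_sub_eq (ν := ν) hT] at hopposite
  set n := pullCount I T i ω
  have hscale := mul_nonpos_of_nonneg_of_nonpos (Nat.cast_nonneg (α := ℝ) n) hopposite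
  have hsum : n * ((∑ k ∈ Finset.range n, rewardNoise ν X i k ω) / n)
      = ∑ k ∈ Finset.range n, rewardNoise ν X i k ω := mul_div_cancel₀ _ (by positivity)
  linear_combination hscale - (armMean ν i - θ) * hsum

variable [MeasurableSpace Ω] {P : Measure Ω}

namespace IsRewardTable

lemma isSubgaussianNoise (hX : IsRewardTable P ν X)
    (hν : ∀ i, ∀ᵐ x ∂(ν i), x ∈ Set.Icc (0 : ℝ) 1) (i : Fin K) :
    IsSubgaussianNoise P (1 / 4) (rewardNoise ν X i) := by
  have := hX.indep.isProbabilityMeasure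
  refine isSubgaussianNoise_sub_mean (hX.measurable i)
    (hX.indep.precomp (g := Prod.mk i) (Prod.mk_right_injective i)) (fun k => ?_) fun k => ?_
  · exact ae_of_ae_map (hX.measurable i k).aemeasurable ((hX.law i k).symm ▸ hν i)
  · rw [armMean, ← hX.law i k]
    exact (integral_map (hX.measurable i k).aemeasurable aestronglyMeasurable_id).symm

lemma iIndepFun_lastBelow (hX : IsRewardTable P ν X) (α θ y : ℝ) (N : ℕ) :
    iIndepFun (fun i ω =>
      (lastBelow α (armMean ν i - θ) (rewardNoise ν X i) y N ω : ℝ)) P := by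
  let f : Fin K → (ℕ → ℝ) → ℝ := fun i x =>
    lastBelow α (armMean ν i - θ) (fun k x => x k - armMean ν i) y N x
  have hf : ∀ i, Measurable (f i) := fun i => measurable_from_top.comp
    (measurable_lastBelow (fun k => (measurable_pi_apply k).sub_const _) α _ y N)
  exact (iIndepFun_rows hX.measurable hX.indep).comp f hf

end IsRewardTable

end Noise

section Pulls

variable {Ω : Type*} {K : ℕ} {I : ℕ → Ω → Fin K} {ω : Ω} {T : ℕ}

lemma pullCount_succ (t : ℕ) (i : Fin K) :
    pullCount I (t + 1) i ω = pullCount I t i ω + if I t ω = i then 1 else 0 := by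
  unfold pullCount
  rw [Finset.range_add_one, Finset.filter_insert]
  split_ifs with h
  · rw [Finset.card_insert_of_notMem (by simp)]
  · rfl

lemma pullCount_mono {t t' : ℕ} (h : t ≤ t') (i : Fin K) (ω : Ω) :
    pullCount I t i ω ≤ pullCount I t' i ω :=
  Finset.card_le_card (Finset.filter_subset_filter _ (Finset.range_mono h))

lemma pullCount_le (t : ℕ) (i : Fin K) : pullCount I t i ω ≤ t :=
  (Finset.card_filter_le _ _).trans_eq (Finset.card_range t)

lemma sum_pullCount (t : ℕ) : ∑ i, pullCount I t i ω = t := by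
  unfold pullCount
  rw [← Finset.card_eq_sum_card_fiberwise fun _ _ => Finset.mem_univ _, Finset.card_range]

lemma exists_pullCount_eq_succ {p : Fin K → ℕ → Prop} (hinit : ∀ i, pullCount I K i ω = 1)
    (hp : ∀ t, K ≤ t → t < T → p (I t ω) (pullCount I t (I t ω) ω)) (hKT : K ≤ T) (i : Fin K) :
    ∃ m, pullCount I T i ω = m + 1 ∧ (m = 0 ∨ p i m) := by
  induction T, hKT using Nat.le_induction with
  | base => exact ⟨0, hinit i, Or.inl rfl⟩
  | succ T hKT ih =>
    rw [pullCount_succ]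
    split_ifs with hi
    · exact ⟨_, rfl, Or.inr (hi ▸ hp T hKT T.lt_succ_self)⟩
    · exact ih fun t hKt htT => hp t hKt (htT.trans T.lt_succ_self)

lemma IsLSARun.exists_round_or_le_add_sum_lastBelow [MeasurableSpace Ω] {α θ : ℝ}
    {X : Fin K → ℕ → Ω → ℝ} (hI : IsLSARun α θ X T I) (hKT : K ≤ T) (ν : Fin K → Measure ℝ)
    (y : ℝ) (ω : Ω) :
    (∃ t, K ≤ t ∧ t < T ∧ ∀ i, y ≤ lsaIndex α θ X I t i ω) ∨
      T ≤ K + ∑ i, lastBelow α (armMean ν i - θ) (rewardNoise ν X i) y T ω := by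
  refine or_iff_not_imp_left.mpr fun hnone => ?_
  push Not at hnone
  have hpulled : ∀ t, K ≤ t → t < T → noiseIndex α (armMean ν (I t ω) - θ)
      (rewardNoise ν X (I t ω)) (pullCount I t (I t ω) ω) ω < y := fun t hKt htT => by
    obtain ⟨j, hj⟩ := hnone t hKt htT
    rw [← lsaIndex_eq_noiseIndex]
    exact (hI.argmin t hKt htT ω j).trans_lt hj
  have hcount : ∀ i, pullCount I T i ω
      ≤ 1 + lastBelow α (armMean ν i - θ) (rewardNoise ν X i) y T ω := fun i => by
    obtain ⟨m, hm, hlast⟩ := exists_pullCount_eq_succ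
      (p := fun i m => noiseIndex α (armMean ν i - θ) (rewardNoise ν X i) m ω < y)
      (hI.init ω) hpulled hKT i
    have hmT : m ≤ T := by
      have := pullCount_le (I := I) (ω := ω) T i
      omega
    rw [hm, add_comm]
    exact Nat.add_le_add_left (le_lastBelow hmT hlast) 1
  calc T = ∑ i, pullCount I T i ω := (sum_pullCount T).symm
    _ ≤ ∑ i, (1 + lastBelow α (armMean ν i - θ) (rewardNoise ν X i) y T ω) :=
        Finset.sum_le_sum fun i _ => hcount i
    _ = _ := by simp [Finset.sum_add_distrib]

end Pulls

section Constants

variable {α : ℝ}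

/-- The factor `exp ((2.1 α - ln α - 0.5) / (4 α))` of `Φ(α)`. -/
def lsaExpConst (α : ℝ) : ℝ := Real.exp ((2.1 * α - Real.log α - 0.5) / (4 * α))

/-- The factor `2 ^ (1 / (8 α)) / (2 ^ (1 / (8 α)) - 1)` of `Φ(α)`. -/
def lsaGeomConst (α : ℝ) : ℝ := (2 : ℝ) ^ (1 / (8 * α)) / ((2 : ℝ) ^ (1 / (8 * α)) - 1)

lemma lsaConst_eq (α : ℝ) : lsaConst α = 9.3 * (lsaExpConst α * lsaGeomConst α) := by
  rw [lsaConst, lsaGeomConst, lsaExpConst]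
  ring

lemma one_le_lsaExpConst (hα : 0 < α) : 1 ≤ lsaExpConst α := by
  refine Real.one_le_exp (div_nonneg ?_ (by positivity))
  linarith [Real.log_le_sub_one_of_pos hα]

lemma one_lt_two_rpow (hα : 0 < α) : 1 < (2 : ℝ) ^ (1 / (8 * α)) :=
  Real.one_lt_rpow one_lt_two (by positivity)

lemma one_le_lsaGeomConst (hα : 0 < α) : 1 ≤ lsaGeomConst α := by
  have := one_lt_two_rpow hα
  rw [lsaGeomConst, one_le_div (by linarith)]
  linarith

lemma inv_one_sub_exp_le_lsaGeomConst (hα : 0 < α) :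
    (1 - Real.exp (-(Real.log 2 / (4 * α))))⁻¹ ≤ lsaGeomConst α := by
  have hratio : Real.exp (-(Real.log 2 / (4 * α))) = ((2 : ℝ) ^ (1 / (8 * α)))⁻¹ ^ 2 := by
    rw [Real.rpow_def_of_pos two_pos, ← Real.exp_neg, ← Real.exp_nat_mul]
    congr 1
    push_cast
    field_simp
    ring
  have hs := one_lt_two_rpow hα
  rw [hratio, lsaGeomConst]
  set s := (2 : ℝ) ^ (1 / (8 * α))
  have hs0 : 0 < s := by linarith
  have hs1 : 0 < s - 1 := by linarith
  rw [show 1 - s⁻¹ ^ 2 = (s - 1) * (s + 1) / s ^ 2 by field_simp; ring, inv_div,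
    div_le_div_iff₀ (by positivity) hs1]
  linarith [mul_pos hs0 hs1]

lemma exp_neg_eighteen_mul_le {u Q : ℝ} (hα : 0 < α) (hQ : 0 < Q)
    (hu : u + Real.log α + 1 ≤ α * Q) :
    Real.exp (-(18 * Q)) ≤ lsaExpConst α * Real.exp (-(u / (5 * α))) := by
  rw [lsaExpConst, ← Real.exp_add]
  gcongr
  have hclear : u / (5 * α) - 18 * Q = (0.8 * u - 72 * (α * Q)) / (4 * α) := by
    field_simp; ring
  have hexponent : (0.8 * u - 72 * (α * Q)) / (4 * α)
      ≤ (2.1 * α - Real.log α - 0.5) / (4 * α) := by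
    gcongr ?_ / _
    linarith [Real.log_le_sub_one_of_pos hα, mul_pos hα hQ]
  linarith

lemma exp_early_le {w : ℝ} (hα : 0 < α) (hw : 0 < w) :
    Real.exp (w / (10 * α) - (w - 1 / 2 * Real.log (w / (10 * α))) / (2 * α))
      ≤ lsaExpConst α * Real.exp (-(w / (5 * α))) := by
  rw [lsaExpConst, ← Real.exp_add]
  gcongr
  have hlog : Real.log (w / (10 * α)) = Real.log (w / 10) - Real.log α := by
    rw [← Real.log_div (by positivity) hα.ne', div_div]
  have hclear : w / (10 * α) - (w - 1 / 2 * Real.log (w / (10 * α))) / (2 * α) + w / (5 * α)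
      = (Real.log (w / 10) - Real.log α - 0.8 * w) / (4 * α) := by
    rw [hlog]; field_simp; ring
  have hexponent : (Real.log (w / 10) - Real.log α - 0.8 * w) / (4 * α)
      ≤ (2.1 * α - Real.log α - 0.5) / (4 * α) := by
    gcongr ?_ / _
    linarith [Real.log_le_sub_one_of_pos (by positivity : 0 < w / 10)]
  linarith

lemma early_bound_le {w : ℝ} (hα : 0 < α) (hw : 0 < w) :
    2 * Real.exp (w / (10 * α) - (w - 1 / 2 * Real.log (w / (10 * α))) / (2 * α))
        / (1 - Real.exp (-(Real.log 2 / (4 * α))))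
      ≤ 2 * (lsaExpConst α * lsaGeomConst α) * Real.exp (-(w / (5 * α))) := by
  have hG : 0 ≤ lsaGeomConst α := zero_le_one.trans (one_le_lsaGeomConst hα)
  calc _ ≤ 2 * Real.exp (w / (10 * α) - (w - 1 / 2 * Real.log (w / (10 * α))) / (2 * α))
          * lsaGeomConst α := by
        rw [div_eq_mul_inv]; gcongr; exact inv_one_sub_exp_le_lsaGeomConst hα
    _ ≤ 2 * (lsaExpConst α * Real.exp (-(w / (5 * α)))) * lsaGeomConst α := by
        gcongr; exact exp_early_le hα hw
    _ = _ := by ring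

lemma total_le_lsaConst_mul (hα : 0 < α) (w : ℝ) :
    (1 + 2 * (lsaExpConst α * lsaGeomConst α)) * Real.exp (-(w / (5 * α)))
        + lsaExpConst α * Real.exp (-(w / (5 * α)))
      ≤ lsaConst α * Real.exp (-(w / (5 * α)) - 1 / 10) := by
  have hG := one_le_lsaGeomConst hα
  have hC := one_le_lsaExpConst hα
  have hCG : lsaExpConst α ≤ lsaExpConst α * lsaGeomConst α :=
    le_mul_of_one_le_right (zero_le_one.trans hC) hG
  rw [lsaConst_eq, Real.exp_sub, ← add_mul, mul_div_assoc', le_div_iff₀ (Real.exp_pos _)]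
  set A := lsaExpConst α * lsaGeomConst α
  have hexp : Real.exp (1 / 10) ≤ 10 / 9 := by
    have h := Real.add_one_le_exp (-(1 / 10 : ℝ))
    rw [Real.exp_neg, le_inv_comm₀ (by norm_num) (Real.exp_pos _)] at h
    exact h.trans (by norm_num)
  have hfactor : (1 + 2 * A + lsaExpConst α) * Real.exp (1 / 10) ≤ 9.3 * A := by
    calc _ ≤ (4 * A) * (10 / 9) := by gcongr; linarith
      _ ≤ 9.3 * A := by linarith
  calc _ = (1 + 2 * A + lsaExpConst α) * Real.exp (1 / 10) * Real.exp (-(w / (5 * α))) := by ring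
    _ ≤ _ := by gcongr

lemma lsaConst_pos (hα : 0 < α) : 0 < lsaConst α := by
  have hG := one_le_lsaGeomConst hα
  have hC := one_le_lsaExpConst hα
  rw [lsaConst_eq]
  positivity

lemma one_le_lsaConst_mul_exp {Δ x : ℝ} (hα : 0 < α) (hΔ : 0 ≤ Δ)
    (h : Δ = 0 ∨ x + Real.log Δ ≤ 0) :
    1 ≤ lsaConst α * Real.exp (-(allocation α Δ x * Δ ^ 2) / 10) := by
  have hG := one_le_lsaGeomConst hα
  have hC := one_le_lsaExpConst hα
  have hle := allocation_mul_sq_le_one (α := α) hΔ h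
  have hCG : 0 ≤ lsaExpConst α * lsaGeomConst α := by positivity
  have hone := total_le_lsaConst_mul hα 0
  simp only [zero_div, neg_zero, Real.exp_zero, mul_one, zero_sub] at hone
  calc (1 : ℝ) ≤ lsaConst α * Real.exp (-(1 / 10)) := by linarith
    _ ≤ _ := by
        gcongr
        · exact (lsaConst_pos hα).le
        · linarith

end Constants

section Regret

variable {Ω : Type*} {K : ℕ} {ν : Fin K → Measure ℝ} {X : Fin K → ℕ → Ω → ℝ} {α θ y Λ : ℝ}
  {I : ℕ → Ω → Fin K} {T : ℕ} {i : Fin K}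

lemma armMean_mem_Icc [IsProbabilityMeasure (ν i)] (hν : ∀ᵐ x ∂(ν i), x ∈ Set.Icc (0 : ℝ) 1) :
    armMean ν i ∈ Set.Icc (0 : ℝ) 1 :=
  (convex_Icc 0 1).integral_mem isClosed_Icc hν (Integrable.of_mem_Icc 0 1 aemeasurable_id hν)

lemma gap_mem_Icc [IsProbabilityMeasure (ν i)] (hν : ∀ᵐ x ∂(ν i), x ∈ Set.Icc (0 : ℝ) 1)
    (hθ : θ ∈ Set.Icc (0 : ℝ) 1) : gap θ ν i ∈ Set.Icc (0 : ℝ) 1 :=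
  ⟨abs_nonneg _, abs_sub_le_of_le_of_le (armMean_mem_Icc hν).1 (armMean_mem_Icc hν).2 hθ.1 hθ.2
    |>.trans_eq (sub_zero 1)⟩

variable [MeasurableSpace Ω] {P : Measure Ω}

lemma measureReal_le_add_sum_lastBelow_le (hX : IsRewardTable P ν X)
    (hν : ∀ i, ∀ᵐ x ∂(ν i), x ∈ Set.Icc (0 : ℝ) 1) (hα : 0 < α) {τ : ℝ} (hτ0 : 0 ≤ τ)
    (hτ : ∀ i, τ ≤ max (Real.exp (-(2 * y))) (gap θ ν i ^ 2) / 2) :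
    P.real {ω | T ≤ K + ∑ i, lastBelow α (armMean ν i - θ) (rewardNoise ν X i) y T ω}
      ≤ Real.exp (-(τ * (T - K - 3 * ∑ i, allocation α (gap θ ν i) y))) := by
  have := hX.indep.isProbabilityMeasure
  have hnoise := hX.isSubgaussianNoise hν
  let S : Fin K → Ω → ℝ := fun i ω => lastBelow α (armMean ν i - θ) (rewardNoise ν X i) y T ω
  have hS : ∀ i, Measurable (S i) := fun i =>
    measurable_from_top.comp (measurable_lastBelow (hnoise i).measurable α _ y T)
  have hindep : iIndepFun S P := hX.iIndepFun_lastBelow α θ y T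
  have hevent : {ω | T ≤ K + ∑ i, lastBelow α (armMean ν i - θ) (rewardNoise ν X i) y T ω}
      = {ω | (T - K : ℝ) ≤ (∑ i, S i) ω} := by
    ext ω
    simp only [S, Set.mem_ofPred_eq, Finset.sum_apply, sub_le_iff_le_add']
    exact_mod_cast Iff.rfl
  calc _ ≤ Real.exp (-τ * (T - K)) * mgf (∑ i, S i) P τ := by
        rw [hevent]
        exact measure_ge_le_exp_mul_mgf _ hτ0 (hindep.integrable_exp_mul_sum hS fun i _ =>
          integrable_exp_mul_lastBelow (hnoise i).measurable α _ y T τ)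
    _ = Real.exp (-τ * (T - K)) * ∏ i, mgf (S i) P τ := by rw [hindep.mgf_sum hS]
    _ ≤ Real.exp (-τ * (T - K)) * ∏ i, Real.exp (3 * τ * allocation α (gap θ ν i) y) := by
        gcongr with i
        · exact fun i _ => mgf_nonneg
        · exact mgf_lastBelow_le (hnoise i) hα hτ0 (hτ i)
    _ = _ := by
        rw [← Real.exp_sum, ← Real.exp_add, ← Finset.mul_sum]
        ring_nf

lemma IsLevel.measureReal_le_add_sum_lastBelow_le (hΛ : IsLevel α (gap θ ν) T Λ)
    (hΛ0 : 0 ≤ Λ) (hX : IsRewardTable P ν X) (hν : ∀ i, ∀ᵐ x ∂(ν i), x ∈ Set.Icc (0 : ℝ) 1)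
    (hα : 0 < α) (hΔ : ∀ i, gap θ ν i ∈ Set.Icc (0 : ℝ) 1) (hy : y ≤ Λ)
    (hi : ∀ j, gap θ ν i ≤ gap θ ν j) :
    P.real {ω | T ≤ K + ∑ j, lastBelow α (armMean ν j - θ) (rewardNoise ν X j) y T ω}
      ≤ lsaExpConst α * Real.exp (-((Λ - y) / (5 * α))) := by
  set D := max (Real.exp (-(2 * y))) (gap θ ν i ^ 2) with hD
  have hD0 : 0 < D := lt_max_of_lt_left (Real.exp_pos _)
  have hDj : ∀ j, D / 2 ≤ max (Real.exp (-(2 * y))) (gap θ ν j ^ 2) / 2 := fun j => by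
    rw [hD]
    gcongr
    · exact (hΔ i).1
    · exact hi j
  have hmono : ∑ j, allocation α (gap θ ν j) y ≤ ∑ j, allocation α (gap θ ν j) Λ :=
    Finset.sum_le_sum fun j _ => (strictMono_allocation hα (hΔ j).1).monotone hy
  have hslack : 36 * allocation α (gap θ ν i) Λ
      ≤ T - K - 3 * ∑ j, allocation α (gap θ ν j) y :=
    (hΛ.thirtySix_mul_allocation_le_sub hα hΔ hΛ0 i).trans (by gcongr)
  calc _ ≤ Real.exp (-(D / 2 * (T - K - 3 * ∑ j, allocation α (gap θ ν j) y))) :=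
        ThresholdingBandit.measureReal_le_add_sum_lastBelow_le hX hν hα (by positivity) hDj
    _ ≤ Real.exp (-(D / 2 * (36 * allocation α (gap θ ν i) Λ))) := by gcongr
    _ = Real.exp (-(18 * (D * allocation α (gap θ ν i) Λ))) := by ring_nf
    _ ≤ _ := exp_neg_eighteen_mul_le hα
        (mul_pos hD0 (one_pos.trans_le (one_le_allocation hα (hΔ i) hΛ0)))
        (sub_add_log_le_mul_allocation hα (hΔ i).1 hy)

lemma IsLSARun.measure_incorrect_inter_le_index_le (hI : IsLSARun α θ X T I)
    (hX : IsRewardTable P ν X) (hν : ∀ i, ∀ᵐ x ∂(ν i), x ∈ Set.Icc (0 : ℝ) 1) (hα : 0 < α)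
    (hgap : gap θ ν i ≠ 0) (hw : 0 < y + Real.log (gap θ ν i)) :
    P ((correctEvent θ ν (lsaOutput θ X I T) i)ᶜ ∩
        {ω | ∃ t, K ≤ t ∧ t < T ∧ y ≤ lsaIndex α θ X I t i ω})
      ≤ ENNReal.ofReal ((1 + 2 * (lsaExpConst α * lsaGeomConst α))
        * Real.exp (-((y + Real.log (gap θ ν i)) / (5 * α)))) := by
  have hnoise := hX.isSubgaussianNoise hν i
  set μ := armMean ν i - θ
  have hμ0 : μ ≠ 0 := abs_ne_zero.mp hgap
  set w := y + Real.log (gap θ ν i)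
  set r := w / (10 * α) with hr
  have hrate : r / |μ| ^ 2 * (-μ) ^ 2 / (2 * (1 / 4 : NNReal)) = w / (5 * α) := by
    rw [neg_sq, sq_abs, hr]; push_cast; field_simp; ring
  have hlate := hnoise.measure_exists_mul_sq_le_mul_sum_le (-μ) (r / |μ| ^ 2)
  rw [hrate] at hlate
  have hearly := (measure_exists_le_noiseIndex_early_le hnoise hα hμ0 y
    (by positivity : 0 < r)).trans (ENNReal.ofReal_le_ofReal (early_bound_le hα hw))
  have hG := one_le_lsaGeomConst hα
  have hC := one_le_lsaExpConst hα
  rw [add_mul, one_mul, ENNReal.ofReal_add (by positivity) (by positivity)]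
  refine (measure_mono ?_).trans ((measure_union_le _ _).trans (add_le_add hlate hearly))
  rintro ω ⟨hbad, t, hKt, htT, hyt⟩
  have hm : 1 ≤ pullCount I t i ω := (hI.init ω i).symm.le.trans (pullCount_mono hKt i ω)
  have hmn : pullCount I t i ω ≤ pullCount I T i ω := pullCount_mono htT.le i ω
  rcases le_total (r / |μ| ^ 2) (pullCount I t i ω : ℝ) with hlarge | hsmall
  · exact Or.inl ⟨pullCount I T i ω, hlarge.trans (Nat.cast_le.mpr hmn),
      mul_sq_le_of_notMem_correctEvent hbad (by omega)⟩
  · exact Or.inr ⟨pullCount I t i ω, hm, hsmall, (lsaIndex_eq_noiseIndex ν t i ω) ▸ hyt⟩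

lemma IsLSARun.measure_incorrect_le_of_high (hI : IsLSARun α θ X T I)
    (hX : IsRewardTable P ν X) (hν : ∀ i, ∀ᵐ x ∂(ν i), x ∈ Set.Icc (0 : ℝ) 1) (hα : 0 < α)
    (hΔ : ∀ i, gap θ ν i ∈ Set.Icc (0 : ℝ) 1) (hKT : K ≤ T)
    (hΛ : IsLevel α (gap θ ν) T Λ) (hΛ0 : 0 ≤ Λ)
    (hgap : gap θ ν i ≠ 0) (hhigh : 0 < Λ + Real.log (gap θ ν i)) :
    P (correctEvent θ ν (lsaOutput θ X I T) i)ᶜ ≤ ENNReal.ofReal (lsaConst α *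
      Real.exp (-(allocation α (gap θ ν i) Λ * gap θ ν i ^ 2) / 10)) := by
  have := hX.indep.isProbabilityMeasure
  -- The level `Λ - w` balances the two failure probabilities: both are of order `exp (-w/(5α))`.
  set w := (Λ + Real.log (gap θ ν i)) / 2 with hw
  have hwy : Λ - w + Real.log (gap θ ν i) = w := by rw [hw]; ring
  obtain ⟨j₀, -, hj₀⟩ := Finset.exists_min_image Finset.univ (gap θ ν) ⟨i, Finset.mem_univ i⟩
  have hrare := hΛ.measureReal_le_add_sum_lastBelow_le hΛ0 hX hν hα hΔ
    (by linarith : Λ - w ≤ Λ) fun j => hj₀ j (Finset.mem_univ j)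
  rw [sub_sub_cancel, ← ENNReal.ofReal_le_ofReal_iff (by have := one_le_lsaExpConst hα; positivity),
    ofReal_measureReal] at hrare
  have hindex := hI.measure_incorrect_inter_le_index_le hX hν hα hgap
    (by linarith : 0 < Λ - w + Real.log (gap θ ν i))
  rw [hwy] at hindex
  have hexponent : -(allocation α (gap θ ν i) Λ * gap θ ν i ^ 2) / 10
      = -(w / (5 * α)) - 1 / 10 := by
    rw [allocation_of_high hgap hhigh, hw]
    field_simp
    ring
  have hC := one_le_lsaExpConst hα
  have hG := one_le_lsaGeomConst hα
  calc _ ≤ P ((correctEvent θ ν (lsaOutput θ X I T) i)ᶜ ∩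
        {ω | ∃ t, K ≤ t ∧ t < T ∧ Λ - w ≤ lsaIndex α θ X I t i ω} ∪
        {ω | T ≤ K + ∑ j,
          lastBelow α (armMean ν j - θ) (rewardNoise ν X j) (Λ - w) T ω}) := by
        refine measure_mono fun ω hω => ?_
        rcases hI.exists_round_or_le_add_sum_lastBelow hKT ν (Λ - w) ω with
          ⟨t, hKt, htT, hy⟩ | hlate
        · exact Or.inl ⟨hω, t, hKt, htT, hy i⟩
        · exact Or.inr hlate
    _ ≤ _ := (measure_union_le _ _).trans (add_le_add hindex hrare)
    _ = _ := (ENNReal.ofReal_add (by positivity) (by positivity)).symm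
    _ ≤ _ := by
        rw [hexponent]
        exact ENNReal.ofReal_le_ofReal (total_le_lsaConst_mul hα w)

lemma IsLSARun.measure_incorrect_le (hI : IsLSARun α θ X T I)
    (hX : IsRewardTable P ν X) (hν : ∀ i, ∀ᵐ x ∂(ν i), x ∈ Set.Icc (0 : ℝ) 1) (hα : 0 < α)
    (hΔ : ∀ i, gap θ ν i ∈ Set.Icc (0 : ℝ) 1) (hT : budgetFactor α * K ≤ T)
    (hΛ : IsLevel α (gap θ ν) T Λ) (i : Fin K) :
    P (correctEvent θ ν (lsaOutput θ X I T) i)ᶜ ≤ ENNReal.ofReal (lsaConst α *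
      Real.exp (-(allocation α (gap θ ν i) Λ * gap θ ν i ^ 2) / 10)) := by
  have := hX.indep.isProbabilityMeasure
  by_cases hlow : gap θ ν i = 0 ∨ Λ + Real.log (gap θ ν i) ≤ 0
  · exact prob_le_one.trans (ENNReal.one_le_ofReal.mpr
      (one_le_lsaConst_mul_exp hα (hΔ i).1 hlow))
  · rw [not_or, not_le] at hlow
    have hKT : (K : ℝ) ≤ T := (le_mul_of_one_le_left (Nat.cast_nonneg K)
      (by norm_num [budgetFactor])).trans hT
    exact hI.measure_incorrect_le_of_high hX hν hα hΔ (Nat.cast_le.mp hKT) hΛ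
      (hΛ.nonneg i.pos hα hΔ hT) hlow.1 hlow.2

lemma aggregateRegret_le [IsFiniteMeasure P] {d : Fin K → Ω → Fin 2} {b : Fin K → ℝ}
    (hb : ∀ i, 0 ≤ b i) (h : ∀ i, P (correctEvent θ ν d i)ᶜ ≤ ENNReal.ofReal (b i)) :
    aggregateRegret P θ ν d ≤ ∑ i, b i := by
  let M : Fin K → Set Ω := fun i => toMeasurable P (correctEvent θ ν d i)ᶜ
  have hM : ∀ i, MeasurableSet (M i) := fun i => measurableSet_toMeasurable _ _
  have hint : ∀ i, Integrable ((M i).indicator fun _ => (1 : ℝ)) P := fun i =>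
    (integrable_const _).indicator (hM i)
  calc aggregateRegret P θ ν d ≤ ∫ ω, ∑ i, (M i).indicator (fun _ => (1 : ℝ)) ω ∂P := by
        refine integral_mono_of_nonneg (ae_of_all _ fun ω => ?_)
          (integrable_finsetSum _ fun i _ => hint i) (ae_of_all _ fun ω => ?_)
        · exact Finset.sum_nonneg fun i _ => Set.indicator_nonneg (fun _ _ => zero_le_one) _
        · exact Finset.sum_le_sum fun i _ => Set.indicator_le_indicator_of_subset
            (subset_toMeasurable _ _) (fun _ => zero_le_one) ω
    _ = ∑ i, P.real (M i) := by
        rw [integral_finsetSum _ fun i _ => hint i]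
        exact Finset.sum_congr rfl fun i _ => integral_indicator_one (hM i)
    _ ≤ ∑ i, b i := by
        gcongr with i
        rw [Measure.real, measure_toMeasurable]
        exact ENNReal.toReal_le_of_le_ofReal (hb i) (h i)

end Regret

end ThresholdingBandit

end

theorem theorem1_general {Ω : Type*} [MeasurableSpace Ω] (P : Measure Ω)
    [IsProbabilityMeasure P] {K : ℕ} (hK : 0 < K) (ν : Fin K → Measure ℝ)
    [∀ i, IsProbabilityMeasure (ν i)] (hν : ∀ i, ∀ᵐ x ∂(ν i), x ∈ Set.Icc (0 : ℝ) 1)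
    (θ : ℝ) (hθ : θ ∈ Set.Icc (0 : ℝ) 1)
    (X : Fin K → ℕ → Ω → ℝ) (hX : ThresholdingBandit.IsRewardTable P ν X)
    (α : ℝ) (hα : 0 < α) (T : ℕ) (hT : max (40 / α + 1) 40 * (K : ℝ) ≤ (T : ℝ))
    (I : ℕ → Ω → Fin K) (hI : ThresholdingBandit.IsLSARun α θ X T I) :
    (∃! Λ : ℝ, ThresholdingBandit.IsLevel α (ThresholdingBandit.gap θ ν) T Λ) ∧
    ∀ Λ : ℝ, ThresholdingBandit.IsLevel α (ThresholdingBandit.gap θ ν) T Λ →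
      ThresholdingBandit.aggregateRegret P θ ν (ThresholdingBandit.lsaOutput θ X I T) ≤
        ThresholdingBandit.lsaConst α *
          ∑ i, Real.exp (-(ThresholdingBandit.allocation α (ThresholdingBandit.gap θ ν i) Λ
            * ThresholdingBandit.gap θ ν i ^ 2) / 10) := by
  open ThresholdingBandit in
  have hΔ : ∀ i, gap θ ν i ∈ Set.Icc (0 : ℝ) 1 := fun i => gap_mem_Icc (hν i) hθ
  refine ⟨existsUnique_isLevel hK hα hΔ hT, fun Λ hΛ => ?_⟩
  rw [Finset.mul_sum]
  exact aggregateRegret_le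
    (fun i => mul_nonneg (lsaConst_pos hα).le (Real.exp_pos _).le)
    fun i => hI.measure_incorrect_le hX hν hα hΔ hT hΛ i

theorem theorem1 {Ω : Type*} [MeasurableSpace Ω] (P : Measure Ω) [IsProbabilityMeasure P]
    {K : ℕ} (hK : 0 < K) (ν : Fin K → Measure ℝ) [∀ i, IsProbabilityMeasure (ν i)]
    (hν : ∀ i, ∀ᵐ x ∂(ν i), x ∈ Set.Icc (0 : ℝ) 1)
    (θ : ℝ) (hθ : θ ∈ Set.Ioo (0 : ℝ) 1)
    (X : Fin K → ℕ → Ω → ℝ) (hX : ThresholdingBandit.IsRewardTable P ν X)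
    (α : ℝ) (hα : 0 < α) (hα8 : α ≤ 8)
    (T : ℕ) (hT : max (40 / α + 1) 40 * (K : ℝ) ≤ (T : ℝ))
    (I : ℕ → Ω → Fin K) (hI : ThresholdingBandit.IsLSARun α θ X T I) :
    (∃! Λ : ℝ, ThresholdingBandit.IsLevel α (ThresholdingBandit.gap θ ν) T Λ) ∧
    ∀ Λ : ℝ, ThresholdingBandit.IsLevel α (ThresholdingBandit.gap θ ν) T Λ →
      ThresholdingBandit.aggregateRegret P θ ν (ThresholdingBandit.lsaOutput θ X I T) ≤
        ThresholdingBandit.lsaConst α *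
          ∑ i, Real.exp (-(ThresholdingBandit.allocation α (ThresholdingBandit.gap θ ν i) Λ
            * ThresholdingBandit.gap θ ν i ^ 2) / 10) :=
  theorem1_general P hK ν hν θ (Set.Ioo_subset_Icc_self hθ) X hX α hα T hT I hI
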